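/- Let $\Sigma=\{0,1\}$, let $\Sigma^\infty$ be the set of infinite binary sequences $x=x_0x_1x_2\dots$, let $T$ be the left shift on $\Sigma^\infty$, let $\mathbb{T}=\mathbb{R}/\mathbb{Z}$ (identified with $[0,1)$), and let $v(x)=\sum_{i\ge 0}x_i2^{-i-1}\bmod 1\in\mathbb{T}$. For a string $w\in\Sigma^l$ let $C_w\subseteq\Sigma^\infty$ be the set of sequences with prefix $w$, and let $I_w=[v(w0^\infty),v(w0^\infty)+2^{-l})\subseteq\mathbb{T}$. The lift $\hat\mu$ of a finite Borel measure $\mu$ on $\mathbb{T}$ is the unique Borel measure on $\Sigma^\infty$ with $\hat\mu(C_w)=\mu(I_w)$ for every finite string $w$. Logarithms are to base $2$, with $0\log 0=0$. For $n\ge l\ge 1$ and $w\in\Sigma^l$ let $$P(x_0^{n-1},w)=\frac{|\{0\le i\le n-l : x_i\cdots x_{i+l-1}=w\}|}{n-l+1},\qquad H_l(x_0^{n-1})=-\frac1l\sum_{w\in\Sigma^l}P(x_0^{n-1},w)\log P(x_0^{n-1},w).$$ The finite-state dimension and the finite-state strong dimension of $x$ are $$\dim_{FS}(x)=\inf_{l\ge1}\liminf_{n\to\infty}H_l(x_0^{n-1}),\qquad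 \mathrm{Dim}_{FS}(x)=\inf_{l\ge1}\limsup_{n\to\infty}H_l(x_0^{n-1}),$$ and $x$ is called regular if they are equal. For a probability measure $\nu$ on $\Sigma^\infty$ let $\mathbf{H}_n(\nu)=-\sum_{w\in\Sigma^n}\nu(C_w)\log\nu(C_w)$, $H^-(\nu)=\liminf_{n\to\infty}\mathbf{H}_n(\nu)/n$ and $H^+(\nu)=\limsup_{n\to\infty}\mathbf{H}_n(\nu)/n$. **Theorem (Weyl's criterion for convergent Weyl averages).** Let $x\in\Sigma^\infty$, and suppose that there are $c_k\in\mathbb{C}$ $(k\in\mathbb{Z})$ such that for every $k\in\mathbb{Z}$ $$\lim_{n\to\infty}\frac1n\sum_{j=0}^{n-1}e^{2\pi i k\,v(T^jx)}=c_k.$$ Then there is a unique Borel measure $\mu$ on $\mathbb{T}$ with $c_k=\int e^{2\pi i ky}\,d\mu(y)$ for every $k\in\mathbb{Z}$, and $\mu$ is a probability measure. Furthermore $$\dim_{FS}(x)=\mathrm{Dim}_{FS}(x)=H^-(\hat\mu)=H^+(\hat\mu);$$ in particular, $x$ is regular. -/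

import Mathlib

open MeasureTheory Filter

namespace WeylFSD

noncomputable section

/-- Infinite binary sequences, with the product topology and the product (= Borel) σ-algebra,
which is the one generated by the cylinder sets. -/
abbrev BinSeq : Type := ℕ → Fin 2

/-- Binary strings of length `l`. -/
abbrev Word (l : ℕ) : Type := Fin l → Fin 2

/-- The left shift `T`. -/
def shift (x : BinSeq) : BinSeq := fun n => x (n + 1)

/-- The evaluation map `v(x) = ∑ xᵢ / 2^(i+1) mod 1`, with values in the torus `ℝ / ℤ`. -/
def eval (x : BinSeq) : UnitAddCircle := ((Real.ofDigits x : ℝ) : UnitAddCircle)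

/-- The `k`-th Weyl average `n⁻¹ ∑_{j<n} exp(2πi k v(T^j x))` of length `n`
(`fourier k` is the character `y ↦ exp(2πi k y)` of `ℝ / ℤ`). -/
def weylAverage (x : BinSeq) (k : ℤ) (n : ℕ) : ℂ :=
  (n : ℂ)⁻¹ * ∑ j ∈ Finset.range n, fourier k (eval (shift^[j] x))

/-- The Fourier coefficient `∫ exp(2πi k y) dμ(y)` of a measure on the torus. -/
def fourierCoeffMeasure (μ : Measure UnitAddCircle) (k : ℤ) : ℂ :=
  ∫ y, fourier k y ∂μ

/-- The cylinder `C_w` of all infinite sequences with prefix `w`. -/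
def cyl {l : ℕ} (w : Word l) : Set BinSeq := {x | ∀ i : Fin l, x i = w i}

/-- The representative in `[0, 1)` of a point of the torus. -/
def rep (r : UnitAddCircle) : ℝ := (AddCircle.equivIco (1 : ℝ) 0 r : ℝ)

/-- The value of `w000…`. -/
def wordValue {l : ℕ} (w : Word l) : ℝ := ∑ i : Fin l, (w i : ℝ) * ((2 : ℝ) ^ ((i : ℕ) + 1))⁻¹

/-- The dyadic interval `I_w = [v(w0^∞), v(w0^∞) + 2^(-|w|))` in the torus `[0, 1)`. -/
def dyadic {l : ℕ} (w : Word l) : Set UnitAddCircle :=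
  {r | rep r ∈ Set.Ico (wordValue w) (wordValue w + ((2 : ℝ) ^ l)⁻¹)}

/-- The standard binary expansion (the one not ending in `111…`) of a point of the torus. -/
def expansion (r : UnitAddCircle) : BinSeq := Real.digits (rep r) 2

/-- The lift `μ̂` of a measure `μ` on the torus to the space of binary sequences. It is the unique
measure with `μ̂(C_w) = μ(I_w)` for all strings `w`: see `lift_cyl` and `lift_unique`. -/
def lift (μ : Measure UnitAddCircle) : Measure BinSeq := μ.map expansion

/-- The sliding count probability `P(x_0^{n-1}, w)` of a string `w` of length `l` in the prefix of
length `n` of `x`, for `n ≥ l`: the proportion of the positions `i ∈ [0, n - l]` at which `w`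
occurs. -/
def slidingProb (x : BinSeq) (n : ℕ) {l : ℕ} (w : Word l) : ℝ :=
  ((Finset.range (n + 1 - l)).filter (fun i => ∀ j : Fin l, x (i + j) = w j)).card
    / ((n : ℝ) - l + 1)

/-- The sliding block entropy `H_l(x_0^{n-1})` (logarithms are to base 2, and `0 log 0 = 0`). -/
def slidingEntropy (x : BinSeq) (l n : ℕ) : ℝ :=
  -(1 / (l : ℝ)) * ∑ w : Word l, slidingProb x n w * Real.logb 2 (slidingProb x n w)

/-- The finite-state dimension; the infimum is over block lengths `l ≥ 1`. -/
def dimFS (x : BinSeq) : ℝ :=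
  ⨅ l : ℕ+, liminf (fun n : ℕ => slidingEntropy x l n) atTop

/-- The finite-state strong dimension; the infimum is over block lengths `l ≥ 1`. -/
def strongDimFS (x : BinSeq) : ℝ :=
  ⨅ l : ℕ+, limsup (fun n : ℕ => slidingEntropy x l n) atTop

/-- A sequence is regular if its finite-state dimension and strong dimension agree. -/
def IsRegular (x : BinSeq) : Prop := dimFS x = strongDimFS x

/-- The entropy `-∑_{|w| = n} μ(C_w) log₂ μ(C_w)`. -/
def cylEntropy (μ : Measure BinSeq) (n : ℕ) : ℝ :=
  -∑ w : Word n, μ.real (cyl w) * Real.logb 2 (μ.real (cyl w))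

/-- The upper average entropy `H⁺`. -/
def upperEntropy (μ : Measure BinSeq) : ℝ :=
  limsup (fun n : ℕ => cylEntropy μ n / n) atTop

/-- The lower average entropy `H⁻`. -/
def lowerEntropy (μ : Measure BinSeq) : ℝ :=
  liminf (fun n : ℕ => cylEntropy μ n / n) atTop

/-! The lift is the measure determined by its values on cylinders. -/

theorem rep_mem (r : UnitAddCircle) : rep r ∈ Set.Ico (0 : ℝ) 1 := by
  have h := (AddCircle.equivIco (1 : ℝ) 0 r).2
  simpa [rep] using h

theorem measurable_expansion : Measurable expansion := by
  have hrep : Measurable rep :=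
    measurable_subtype_coe.comp (AddCircle.measurableEquivIco (1 : ℝ) 0).measurable
  refine measurable_pi_lambda _ fun i => ?_
  exact (measurable_of_countable (Fin.ofNat 2)).comp
    (Nat.measurable_floor.comp (hrep.mul_const _))

theorem digits_eq_of_sum_eq {y : ℝ} (a : BinSeq) (n : ℕ)
    (h : (2 : ℝ) ^ n * ∑ i ∈ Finset.range n, Real.ofDigitsTerm a i
      = (2 : ℝ) ^ n * ∑ i ∈ Finset.range n, Real.ofDigitsTerm (Real.digits y 2) i) :
    ∀ i < n, Real.digits y 2 i = a i := by
  have key : ∀ b : BinSeq, ∀ m : ℕ, ∃ N : ℕ,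
      (2 : ℝ) ^ m * ∑ i ∈ Finset.range m, Real.ofDigitsTerm b i = N := by
    intro b m
    induction m with
    | zero => exact ⟨0, by simp⟩
    | succ m ih =>
      obtain ⟨N, hN⟩ := ih
      refine ⟨2 * N + b m, ?_⟩
      rw [Finset.sum_range_succ, mul_add, pow_succ', mul_assoc, hN, Real.ofDigitsTerm]
      push_cast
      field_simp
      ring
  have step : ∀ b : BinSeq, ∀ m : ℕ,
      (2 : ℝ) ^ (m + 1) * ∑ i ∈ Finset.range (m + 1), Real.ofDigitsTerm b i
        = 2 * ((2 : ℝ) ^ m * ∑ i ∈ Finset.range m, Real.ofDigitsTerm b i) + (b m : ℕ) := by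
    intro b m
    rw [Finset.sum_range_succ, mul_add, pow_succ', mul_assoc, Real.ofDigitsTerm]
    push_cast
    field_simp
    ring
  induction n with
  | zero => intro i hi; omega
  | succ n ih =>
    rw [step, step] at h
    obtain ⟨N, hN⟩ := key a n
    obtain ⟨M, hM⟩ := key (Real.digits y 2) n
    rw [hN, hM] at h
    have h' : 2 * N + (a n : ℕ) = 2 * M + (Real.digits y 2 n : ℕ) := by exact_mod_cast h
    have h1 := (a n).isLt
    have h2 := (Real.digits y 2 n).isLt
    have hNM : N = M := by omega
    intro i hi
    rcases Nat.lt_succ_iff_lt_or_eq.mp hi with hi | rfl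
    · exact ih (by rw [hN, hM, hNM]) i hi
    · exact Fin.ext (by omega)

theorem expansion_mem_cyl {l : ℕ} (w : Word l) (r : UnitAddCircle) :
    expansion r ∈ cyl w ↔ r ∈ dyadic w := by
  have hy := rep_mem r
  set y := rep r with hyr
  have hp : (0 : ℝ) < 2 ^ l := by positivity
  have hfl := Real.ofDigits_digits_sum_eq (b := 2) hy l
  push_cast at hfl
  have hfl1 := Nat.floor_le (a := (2 : ℝ) ^ l * y) (by have := hy.1; positivity)
  have hfl2 := Nat.lt_floor_add_one ((2 : ℝ) ^ l * y)
  let a : BinSeq := fun i => if h : i < l then w ⟨i, h⟩ else 0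
  have hval : wordValue w = ∑ i ∈ Finset.range l, Real.ofDigitsTerm a i := by
    rw [wordValue, Finset.sum_range]
    refine Finset.sum_congr rfl fun i _ => ?_
    simp [Real.ofDigitsTerm, a]
  have hmem : r ∈ dyadic w ↔ (2 : ℝ) ^ l * wordValue w ≤ 2 ^ l * y ∧
      (2 : ℝ) ^ l * y < 2 ^ l * wordValue w + 1 := by
    have e : (2 : ℝ) ^ l * wordValue w + 1 = 2 ^ l * (wordValue w + ((2 : ℝ) ^ l)⁻¹) := by
      field_simp
    rw [e, mul_le_mul_iff_right₀ hp, mul_lt_mul_iff_right₀ hp]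
    rfl
  rw [hmem]
  constructor
  · intro h
    have : wordValue w = ∑ i ∈ Finset.range l, Real.ofDigitsTerm (Real.digits y 2) i := by
      rw [hval]
      refine Finset.sum_congr rfl fun i hi => ?_
      have hi := Finset.mem_range.mp hi
      have := h ⟨i, hi⟩
      simp only [expansion, ← hyr] at this
      simp [Real.ofDigitsTerm, a, hi, this]
    rw [this, hfl]
    exact ⟨hfl1, hfl2⟩
  · rintro ⟨h1, h2⟩
    obtain ⟨N, hN⟩ : ∃ N : ℕ, (2 : ℝ) ^ l * wordValue w = N := by
      refine ⟨∑ i : Fin l, (w i : ℕ) * 2 ^ (l - 1 - (i : ℕ)), ?_⟩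
      rw [wordValue, Finset.mul_sum]
      push_cast
      refine Finset.sum_congr rfl fun i _ => ?_
      have : (2 : ℝ) ^ l = 2 ^ (l - 1 - (i : ℕ)) * 2 ^ ((i : ℕ) + 1) := by
        rw [← pow_add]
        congr 1
        have := i.isLt
        omega
      rw [this]
      field_simp
    rw [hN] at h1 h2
    have hfloor : ⌊(2 : ℝ) ^ l * y⌋₊ = N :=
      (Nat.floor_eq_iff (by have := hy.1; positivity)).2 ⟨h1, h2⟩
    have := digits_eq_of_sum_eq a l (by rw [← hval, hN, hfl, hfloor])
    intro i
    have h3 := this i i.isLt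
    simpa [expansion, ← hyr, a] using h3

theorem measurableSet_cyl {l : ℕ} (w : Word l) : MeasurableSet (cyl w) := by
  have : cyl w = ⋂ i : Fin l, (fun x : BinSeq => x i) ⁻¹' {w i} := by
    ext x; simp [cyl]
  rw [this]
  exact MeasurableSet.iInter fun i => measurable_pi_apply _ (measurableSet_singleton _)

/-- The defining property of the lift. -/
theorem lift_cyl (μ : Measure UnitAddCircle) {l : ℕ} (w : Word l) :
    lift μ (cyl w) = μ (dyadic w) := by
  rw [lift, Measure.map_apply measurable_expansion (measurableSet_cyl w)]
  congr 1
  ext r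
  exact expansion_mem_cyl w r

/-- The defining property determines the lift. -/
theorem lift_unique (μ : Measure UnitAddCircle) [IsFiniteMeasure μ] (ρ : Measure BinSeq)
    (h : ∀ (l : ℕ) (w : Word l), ρ (cyl w) = μ (dyadic w)) : ρ = lift μ := by
  have hfin : IsFiniteMeasure (lift μ) := by unfold lift; infer_instance
  let p (l : ℕ) (x : BinSeq) : Word l := fun i => x i
  have hp : ∀ l, Measurable (p l) := fun l => measurable_pi_lambda _ fun i => measurable_pi_apply _
  let C : Set (Set BinSeq) := {s | ∃ (l : ℕ) (A : Set (Word l)), s = p l ⁻¹' A}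
  have huniv : ρ Set.univ = lift μ Set.univ := by
    have h0 := (h 0 Fin.elim0).trans (lift_cyl μ Fin.elim0).symm
    have : cyl (Fin.elim0 : Word 0) = Set.univ := by ext x; simp [cyl]
    rwa [this] at h0
  have hρ : IsFiniteMeasure ρ := ⟨by rw [huniv]; exact measure_lt_top _ _⟩
  refine ext_of_generate_finite C ?_ ?_ ?_ huniv
  · apply le_antisymm
    · refine iSup_le fun i => ?_
      rintro s ⟨t, -, rfl⟩
      refine MeasurableSpace.measurableSet_generateFrom
        ⟨i + 1, {u | u (Fin.last i) ∈ t}, ?_⟩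
      ext x
      simp [p]
    · refine MeasurableSpace.generateFrom_le ?_
      rintro s ⟨l, A, rfl⟩
      exact hp l (Set.toFinite A).measurableSet
  · rintro s ⟨l, A, rfl⟩ t ⟨m, B, rfl⟩ -
    refine ⟨l + m, {u | (fun i => u (Fin.castAdd m i)) ∈ A ∧
      (fun i : Fin m => u ⟨i, by omega⟩) ∈ B}, ?_⟩
    ext x
    simp [p]
  · rintro s ⟨l, A, rfl⟩
    have hmap : ρ.map (p l) = (lift μ).map (p l) := by
      refine Measure.ext_of_singleton fun w => ?_
      rw [Measure.map_apply (hp l) (measurableSet_singleton _),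
        Measure.map_apply (hp l) (measurableSet_singleton _)]
      have : p l ⁻¹' {w} = cyl w := by
        ext x
        simp [p, cyl, funext_iff]
      rw [this, h, lift_cyl]
    rw [← Measure.map_apply (hp l) (Set.toFinite A).measurableSet, hmap,
      Measure.map_apply (hp l) (Set.toFinite A).measurableSet]

end

end WeylFSD

namespace WeylFSD

/-! ### Entropy of cylinders -/

/-! Probability measures on `BinSeq` form a compact space, so the empirical measures of the orbit of
`x` converge along every ultrafilter. A limit `ν` along an ultrafilter finer than `atTop` is
shift-invariant, and since `eval` is continuous, its image on the torus has the Fourier coefficients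
`c k`; hence that image is one and the same measure `μ` for all such ultrafilters.

The limit `ν` itself is not determined by `μ`, because `eval` identifies `000…` with `111…`. By
invariance this is the only ambiguity up to null sets: `lift μ` arises from `ν` by moving the atom
at `111…` to `000…`. Block entropies of `ν` and `lift μ` thus differ by at most one bit
(`abs_cylEntropy_sub_lift_le`).

Cylinders are clopen, so the sliding entropy of block length `l` tends along the ultrafilter to
`cylEntropy ν l / l`. Block entropy is subadditive, so by Fekete's lemma the common entropy rate `h`
satisfies `h ≤ cylEntropy ν l / l ≤ (cylEntropy (lift μ) l + 1) / l`. These bounds do not depend on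
the ultrafilter, so they hold for the lower and upper limits, and `l → ∞` makes both dimensions
equal to `h`. -/

theorem cylEntropy_eq (ν : Measure BinSeq) (n : ℕ) :
    cylEntropy ν n = (∑ w : Word n, Real.negMulLog (ν.real (cyl w))) / Real.log 2 := by
  rw [cylEntropy, ← Finset.sum_neg_distrib, Finset.sum_div]
  refine Finset.sum_congr rfl fun w _ => ?_
  rw [Real.negMulLog, Real.logb]
  ring

theorem cylEntropy_nonneg (ν : Measure BinSeq) [IsProbabilityMeasure ν] (n : ℕ) :
    0 ≤ cylEntropy ν n := by
  rw [cylEntropy_eq]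
  exact div_nonneg (Finset.sum_nonneg fun w _ =>
    Real.negMulLog_nonneg measureReal_nonneg measureReal_le_one) (Real.log_nonneg one_le_two)

theorem bddBelow_cylEntropy_div (ν : Measure BinSeq) [IsProbabilityMeasure ν] :
    BddBelow (Set.range fun n : ℕ => cylEntropy ν n / n) :=
  ⟨0, by rintro _ ⟨n, rfl⟩; exact div_nonneg (cylEntropy_nonneg ν n) n.cast_nonneg⟩

/-- This is `log t ≤ t - 1` at `t = q * r / p`, multiplied by `p`. The error `q * r - p` sums to
zero over a joint distribution. -/
theorem negMulLog_le_of_marginals {p q r : ℝ} (hp : 0 ≤ p) (hpq : p ≤ q) (hpr : p ≤ r) :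
    Real.negMulLog p ≤ -(p * Real.log q) - p * Real.log r + (q * r - p) := by
  rcases hp.eq_or_lt with rfl | hp
  · simpa using mul_nonneg hpq hpr
  have hq := hp.trans_le hpq
  have hr := hp.trans_le hpr
  have h := Real.log_le_sub_one_of_pos (show 0 < q * r / p by positivity)
  rw [Real.log_div (by positivity) hp.ne', Real.log_mul hq.ne' hr.ne'] at h
  have h2 := mul_le_mul_of_nonneg_left h hp.le
  have h3 : p * (q * r / p - 1) = q * r - p := by field_simp
  rw [Real.negMulLog]
  linarith

/-- The entropy of a joint distribution is at most the sum of the entropies of its marginals. -/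
theorem sum_negMulLog_le_of_marginals {α β : Type*} [Fintype α] [Fintype β]
    (p : α → β → ℝ) (q : α → ℝ) (r : β → ℝ) (hp : ∀ a b, 0 ≤ p a b)
    (hq : ∀ a, ∑ b, p a b = q a) (hr : ∀ b, ∑ a, p a b = r b)
    (hq1 : ∑ a, q a = 1) (hr1 : ∑ b, r b = 1) :
    ∑ a, ∑ b, Real.negMulLog (p a b)
      ≤ ∑ a, Real.negMulLog (q a) + ∑ b, Real.negMulLog (r b) := by
  have hpq : ∀ a b, p a b ≤ q a := fun a b => by
    rw [← hq]; exact Finset.single_le_sum (fun b _ => hp a b) (Finset.mem_univ b)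
  have hpr : ∀ a b, p a b ≤ r b := fun a b => by
    rw [← hr]; exact Finset.single_le_sum (f := fun a => p a b) (fun a _ => hp a b)
      (Finset.mem_univ a)
  calc ∑ a, ∑ b, Real.negMulLog (p a b)
      ≤ ∑ a, ∑ b, (-(p a b * Real.log (q a)) - p a b * Real.log (r b) + (q a * r b - p a b)) :=
        Finset.sum_le_sum fun a _ => Finset.sum_le_sum fun b _ =>
          negMulLog_le_of_marginals (hp a b) (hpq a b) (hpr a b)
    _ = ∑ a, Real.negMulLog (q a) + ∑ b, Real.negMulLog (r b) := by
        simp only [Finset.sum_add_distrib, Finset.sum_sub_distrib, Finset.sum_neg_distrib]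
        have e1 : ∑ a, ∑ b, p a b * Real.log (q a) = ∑ a, q a * Real.log (q a) :=
          Finset.sum_congr rfl fun a _ => by rw [← Finset.sum_mul, hq]
        have e2 : ∑ a, ∑ b, p a b * Real.log (r b) = ∑ b, r b * Real.log (r b) := by
          rw [Finset.sum_comm]
          exact Finset.sum_congr rfl fun b _ => by rw [← Finset.sum_mul, hr]
        have e3 : ∑ a, ∑ b, q a * r b = 1 := by
          simp_rw [← Finset.mul_sum, hr1, mul_one, hq1]
        have e4 : ∑ a, ∑ b, p a b = 1 := by simp_rw [hq, hq1]
        rw [e1, e2, e3, e4]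
        simp only [Real.negMulLog, neg_mul, Finset.sum_neg_distrib]
        ring

theorem iterate_shift_apply (m : ℕ) (x : BinSeq) (i : ℕ) : shift^[m] x i = x (i + m) := by
  induction m generalizing x with
  | zero => rfl
  | succ m ih => rw [Function.iterate_succ_apply, ih, shift]; congr 1

theorem continuous_shift : Continuous shift :=
  continuous_pi fun i => continuous_apply (i + 1)

/-- The cylinders of length `l` partition the space. Taking for `f` an iterate of the shift or the
identity gives the two marginals of the law of a concatenated word. -/
theorem sum_measureReal_inter_preimage_cyl (ν : Measure BinSeq) [IsFiniteMeasure ν]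
    (A : Set BinSeq) {f : BinSeq → BinSeq} (hf : Measurable f) (l : ℕ) :
    ∑ w : Word l, ν.real (A ∩ f ⁻¹' cyl w) = ν.real A := by
  let g : BinSeq → Word l := fun y i => f y i
  have hg : ∀ w, g ⁻¹' {w} = f ⁻¹' cyl w := fun w => by
    ext y; simp [g, cyl, funext_iff]
  have hm : ∀ w : Word l, MeasurableSet (f ⁻¹' cyl w) := fun w => hf (measurableSet_cyl w)
  have h := sum_measureReal_preimage_singleton (μ := ν.restrict A) (Finset.univ : Finset (Word l))
    (f := g) (fun w _ => by rw [hg]; exact hm w)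
  simp only [hg, Finset.coe_univ, Set.preimage_univ] at h
  rw [measureReal_restrict_apply_univ] at h
  rw [← h]
  exact Finset.sum_congr rfl fun w _ => by
    rw [measureReal_restrict_apply (hm w), Set.inter_comm]

theorem sum_measureReal_cyl (ν : Measure BinSeq) [IsProbabilityMeasure ν] (l : ℕ) :
    ∑ w : Word l, ν.real (cyl w) = 1 := by
  simpa using sum_measureReal_inter_preimage_cyl ν Set.univ measurable_id l

theorem cyl_append {m n : ℕ} (u : Word m) (w : Word n) :
    cyl (Fin.append u w) = cyl u ∩ shift^[m] ⁻¹' cyl w := by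
  ext y
  simp only [cyl, Set.mem_ofPred_eq, Set.mem_inter_iff, Set.mem_preimage, iterate_shift_apply]
  rw [Fin.forall_fin_add]
  simp [add_comm]

/-- The block entropy of a shift-invariant measure is subadditive. -/
theorem subadditive_cylEntropy {ν : Measure BinSeq} [IsProbabilityMeasure ν]
    (hν : MeasurePreserving shift ν ν) : Subadditive (cylEntropy ν) := by
  intro m n
  simp only [cylEntropy_eq, ← add_div]
  refine div_le_div_of_nonneg_right ?_ (Real.log_nonneg one_le_two)
  rw [← (Fin.appendEquiv m n).sum_comp, Fintype.sum_prod_type]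
  refine sum_negMulLog_le_of_marginals (fun u w => ν.real (cyl (Fin.append u w))) _ _
    (fun _ _ => measureReal_nonneg) (fun u => ?_) (fun w => ?_)
    (sum_measureReal_cyl ν m) (sum_measureReal_cyl ν n)
  · simp_rw [cyl_append]
    exact sum_measureReal_inter_preimage_cyl ν _ (continuous_shift.iterate m).measurable n
  -- Summing out the first `m` letters leaves the mass of `shift^[m] ⁻¹' cyl w`; only this marginal
  -- needs invariance.
  · simp_rw [cyl_append, Set.inter_comm (cyl _)]
    have h := sum_measureReal_inter_preimage_cyl ν (shift^[m] ⁻¹' cyl w) measurable_id m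
    simp only [Set.preimage_id] at h
    rw [h, measureReal_def, (hν.iterate m).measure_preimage (measurableSet_cyl w).nullMeasurableSet,
      ← measureReal_def]

/-! ### Entropy when two atoms are merged or split -/

theorem negMulLog_add_le {a b : ℝ} (ha : 0 ≤ a) (hb : 0 ≤ b) :
    Real.negMulLog (a + b) ≤ Real.negMulLog a + Real.negMulLog b := by
  have key : ∀ {s t : ℝ}, 0 ≤ s → 0 ≤ t → s * Real.log s ≤ s * Real.log (s + t) := by
    intro s t hs ht
    rcases hs.eq_or_lt with rfl | hs
    · simp
    · exact mul_le_mul_of_nonneg_left (Real.log_le_log hs (by linarith)) hs.le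
  have h1 := key ha hb
  have h2 := key hb ha
  rw [add_comm b a] at h2
  simp only [Real.negMulLog]
  linarith

/-- Concavity at the midpoint: an even split is the worst case and costs `log 2` per unit of mass.
-/
theorem negMulLog_add_negMulLog_le {a b : ℝ} (ha : 0 ≤ a) (hb : 0 ≤ b) :
    Real.negMulLog a + Real.negMulLog b ≤ Real.negMulLog (a + b) + (a + b) * Real.log 2 := by
  have h := Real.concaveOn_negMulLog.2 (Set.mem_Ici.2 ha) (Set.mem_Ici.2 hb)
    (show (0 : ℝ) ≤ 1 / 2 by norm_num) (show (0 : ℝ) ≤ 1 / 2 by norm_num) (by norm_num)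
  simp only [smul_eq_mul] at h
  rcases (add_nonneg ha hb).eq_or_lt with h0 | h0
  · have ha0 : a = 0 := by linarith
    have hb0 : b = 0 := by linarith
    simp [ha0, hb0]
  · have e : 1 / 2 * a + 1 / 2 * b = (a + b) / 2 := by ring
    rw [e, Real.negMulLog, Real.negMulLog, Real.negMulLog, Real.log_div h0.ne' two_ne_zero] at h
    simp only [Real.negMulLog]
    linarith

/-- Measures that agree on all but two cylinders of a given length, and on the union of these two,
have block entropies of that length at distance at most `1`. -/
theorem cylEntropy_le_add_one {ν ρ : Measure BinSeq} [IsProbabilityMeasure ν]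
    [IsProbabilityMeasure ρ] {l : ℕ} {u v : Word l} (huv : u ≠ v)
    (h : ∀ w, w ≠ u → w ≠ v → ν.real (cyl w) = ρ.real (cyl w)) :
    cylEntropy ν l ≤ cylEntropy ρ l + 1 := by
  have hlog : 0 < Real.log 2 := Real.log_pos one_lt_two
  have split : ∀ f : Word l → ℝ,
      ∑ w, f w = f u + f v + ∑ w ∈ (Finset.univ.erase u).erase v, f w := by
    intro f
    rw [add_assoc, Finset.add_sum_erase _ _ (by simp [huv.symm]),
      Finset.add_sum_erase _ _ (Finset.mem_univ u)]
  have hrest : ∀ g : ℝ → ℝ, ∑ w ∈ (Finset.univ.erase u).erase v, g (ν.real (cyl w))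
      = ∑ w ∈ (Finset.univ.erase u).erase v, g (ρ.real (cyl w)) := fun g =>
    Finset.sum_congr rfl fun w hw => by
      simp only [Finset.mem_erase, Finset.mem_univ, and_true] at hw
      rw [h w hw.2 hw.1]
  have h1 := sum_measureReal_cyl ν l
  have h2 := sum_measureReal_cyl ρ l
  have h0 : (0 : ℝ) ≤ ∑ w ∈ (Finset.univ.erase u).erase v, ρ.real (cyl w) :=
    Finset.sum_nonneg fun _ _ => measureReal_nonneg
  have hr := hrest id
  simp only [id] at hr
  rw [split, hr] at h1
  rw [split] at h2
  -- The mass of the union needs no separate hypothesis, since both measures have total mass one.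
  have hsum : ν.real (cyl u) + ν.real (cyl v) = ρ.real (cyl u) + ρ.real (cyl v) := by linarith
  have hle : (ν.real (cyl u) + ν.real (cyl v)) * Real.log 2 ≤ Real.log 2 :=
    mul_le_of_le_one_left hlog.le (by linarith)
  have h3 := negMulLog_add_negMulLog_le (a := ν.real (cyl u)) (b := ν.real (cyl v))
    measureReal_nonneg measureReal_nonneg
  have h4 := negMulLog_add_le (a := ρ.real (cyl u)) (b := ρ.real (cyl v))
    measureReal_nonneg measureReal_nonneg
  rw [← hsum] at h4
  rw [cylEntropy_eq, cylEntropy_eq, div_add_one hlog.ne']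
  refine div_le_div_of_nonneg_right ?_ hlog.le
  rw [split, split, hrest]
  linarith

/-! ### Symbolic sequences and the torus -/

/-- The sequence `111…`. -/
def ones : BinSeq := fun _ => 1

theorem shift_ones : shift ones = ones := rfl

theorem ofDigits_ones : Real.ofDigits ones = 1 := by
  exact Real.ofDigits_const_last_eq_one' (b := 2) one_lt_two

theorem ofDigits_lt_one {y : BinSeq} (hy : y ≠ ones) : Real.ofDigits y < 1 := by
  obtain ⟨i, hi⟩ := Function.ne_iff.1 hy
  rw [← ofDigits_ones]
  have hval : ∀ j, ((y j : ℕ) : ℝ) ≤ 1 := fun j => by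
    have := (y j).isLt
    exact_mod_cast (by omega : (y j : ℕ) ≤ 1)
  refine Summable.tsum_lt_tsum (i := i) (fun j => ?_) ?_ Real.summable_ofDigitsTerm
    Real.summable_ofDigitsTerm
  · simp only [Real.ofDigitsTerm, ones]
    refine mul_le_mul_of_nonneg_right ?_ (by positivity)
    simpa using hval j
  · have h0 : y i = 0 := by
      have := (y i).isLt
      have hne : y i ≠ 1 := hi
      omega
    simp [Real.ofDigitsTerm, ones, h0]

theorem eval_ones : eval ones = 0 := by
  rw [eval, ofDigits_ones]
  exact AddCircle.coe_period 1

theorem rep_coe {r : ℝ} (hr : r ∈ Set.Ico (0 : ℝ) 1) : rep (r : UnitAddCircle) = r := by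
  have h : r ∈ Set.Ico (0 : ℝ) (0 + 1) := by simpa using hr
  rw [rep, AddCircle.equivIco_coe_eq h]

theorem expansion_zero : expansion 0 = fun _ => 0 := by
  have h : rep 0 = 0 := by simpa using rep_coe (r := 0) (by simp)
  funext i
  simp [expansion, h, Real.digits]

theorem expansion_eval_ones : expansion (eval ones) = fun _ => 0 := by
  rw [eval_ones, expansion_zero]

/-- A sequence that does not end in `111…` is the standard expansion of its value. -/
theorem expansion_eval {y : BinSeq} (hy : ∀ n, shift^[n] y ≠ ones) : expansion (eval y) = y := by
  -- The value of `y` exceeds that of its prefix by `2^(-l)` times the value of `shift^[l] y`, which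
  -- is below `1` because this tail is not `111…`.
  have h : ∀ l : ℕ, expansion (eval y) ∈ cyl (fun i : Fin l => y i) := by
    intro l
    rw [expansion_mem_cyl, dyadic, Set.mem_ofPred_eq, eval,
      rep_coe ⟨Real.ofDigits_nonneg y, ofDigits_lt_one (hy 0)⟩]
    have hs : (fun i => y (i + l)) = shift^[l] y := by
      funext i; rw [iterate_shift_apply]
    have hval : wordValue (fun i : Fin l => y i)
        = ∑ i ∈ Finset.range l, Real.ofDigitsTerm y i := by
      rw [wordValue, Finset.sum_range]
      simp [Real.ofDigitsTerm]
    have e := Real.ofDigits_eq_sum_add_ofDigits y l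
    rw [hs, ← hval] at e
    push_cast at e
    have hp : (0 : ℝ) < ((2 : ℝ) ^ l)⁻¹ := by positivity
    have h0 := Real.ofDigits_nonneg (shift^[l] y)
    have h1 := ofDigits_lt_one (hy l)
    constructor
    · rw [e]; nlinarith
    · rw [e]; nlinarith
  funext i
  exact h (i + 1) (Fin.last i)

theorem continuous_eval : Continuous eval :=
  (AddCircle.continuous_mk' 1).comp Real.continuous_ofDigits

/-- Almost every point of a shift-invariant measure is `111…` or does not end in `111…`. -/
theorem ae_eq_ones_or_iterate_ne_ones {ν : Measure BinSeq} [IsFiniteMeasure ν]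
    (hν : MeasurePreserving shift ν ν) :
    ∀ᵐ y ∂ν, y = ones ∨ ∀ n, shift^[n] y ≠ ones := by
  have h : ∀ n : ℕ, ∀ᵐ y ∂ν, y = ones ∨ shift^[n] y ≠ ones := by
    intro n
    have hm : MeasurableSet ({ones} : Set BinSeq) := measurableSet_singleton _
    have hsub : ({ones} : Set BinSeq) ⊆ shift^[n] ⁻¹' {ones} := by
      rintro _ rfl
      exact Function.iterate_fixed shift_ones n
    -- Nested sets of equal finite mass differ by a null set.
    have h0 : ν (shift^[n] ⁻¹' {ones} \ {ones}) = 0 := by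
      rw [measure_sdiff hsub hm.nullMeasurableSet (measure_ne_top _ _),
        (hν.iterate n).measure_preimage hm.nullMeasurableSet, tsub_self]
    rw [ae_iff]
    refine measure_mono_null (fun y hy => ?_) h0
    simp only [Set.mem_ofPred_eq, not_or, not_not] at hy
    exact ⟨hy.2, hy.1⟩
  filter_upwards [ae_all_iff.2 h] with y hy
  by_cases h1 : y = ones
  · exact Or.inl h1
  · exact Or.inr fun n => (hy n).resolve_left h1

theorem lift_map_eval (ν : Measure BinSeq) :
    lift (ν.map eval) = ν.map (expansion ∘ eval) := by
  rw [lift, Measure.map_map measurable_expansion continuous_eval.measurable]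

instance (μ : Measure UnitAddCircle) [IsProbabilityMeasure μ] : IsProbabilityMeasure (lift μ) :=
  Measure.isProbabilityMeasure_map measurable_expansion.aemeasurable

/-- The lift of the projection of a shift-invariant measure is shift-invariant. -/
theorem measurePreserving_shift_lift_map_eval {ν : Measure BinSeq} [IsFiniteMeasure ν]
    (hν : MeasurePreserving shift ν ν) :
    MeasurePreserving shift (lift (ν.map eval)) (lift (ν.map eval)) := by
  have hm : Measurable (expansion ∘ eval) := measurable_expansion.comp continuous_eval.measurable
  refine ⟨continuous_shift.measurable, ?_⟩
  rw [lift_map_eval, Measure.map_map continuous_shift.measurable hm]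
  -- Almost everywhere `expansion ∘ eval` is either the identity or sends the fixed point `111…` to
  -- the fixed point `000…`, so it commutes with the shift.
  have hae : shift ∘ (expansion ∘ eval) =ᵐ[ν] (expansion ∘ eval) ∘ shift := by
    filter_upwards [ae_eq_ones_or_iterate_ne_ones hν] with y hy
    simp only [Function.comp_apply]
    rcases hy with rfl | hy
    · rw [shift_ones, expansion_eval_ones]; rfl
    · rw [expansion_eval hy, expansion_eval]
      intro n
      rw [← Function.iterate_succ_apply]
      exact hy _
  rw [Measure.map_congr hae, ← Measure.map_map hm continuous_shift.measurable, hν.map_eq]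

/-- A shift-invariant measure agrees with the lift of its projection on the cylinders of
nonconstant words. -/
theorem lift_map_eval_cyl {ν : Measure BinSeq} [IsFiniteMeasure ν]
    (hν : MeasurePreserving shift ν ν) {l : ℕ} {w : Word l} (h0 : w ≠ fun _ => 0)
    (h1 : w ≠ fun _ => 1) : (lift (ν.map eval)).real (cyl w) = ν.real (cyl w) := by
  have hm : Measurable (expansion ∘ eval) := measurable_expansion.comp continuous_eval.measurable
  rw [lift_map_eval, measureReal_def, measureReal_def, Measure.map_apply hm (measurableSet_cyl w)]
  congr 1
  refine measure_congr ?_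
  filter_upwards [ae_eq_ones_or_iterate_ne_ones hν] with y hy
  refine propext ?_
  change expansion (eval y) ∈ cyl w ↔ y ∈ cyl w
  rcases hy with rfl | hy
  · rw [expansion_eval_ones]
    constructor
    · exact fun h => absurd (funext fun i => (h i).symm) h0
    · exact fun h => absurd (funext fun i => (h i).symm) h1
  · rw [expansion_eval hy]

theorem abs_cylEntropy_sub_lift_le {ν : Measure BinSeq} [IsProbabilityMeasure ν]
    (hν : MeasurePreserving shift ν ν) {l : ℕ} (hl : l ≠ 0) :
    |cylEntropy ν l - cylEntropy (lift (ν.map eval)) l| ≤ 1 := by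
  have : IsProbabilityMeasure (ν.map eval) :=
    Measure.isProbabilityMeasure_map continuous_eval.aemeasurable
  -- For `l = 0` the two constant words would coincide.
  have hne : (fun _ => 0 : Word l) ≠ fun _ => 1 := fun h => by
    simpa using congrFun h ⟨0, Nat.pos_of_ne_zero hl⟩
  rw [abs_le]
  have h1 := cylEntropy_le_add_one (ν := ν) (ρ := lift (ν.map eval)) hne
    fun w h0 h1 => (lift_map_eval_cyl hν h0 h1).symm
  have h2 := cylEntropy_le_add_one (ν := lift (ν.map eval)) (ρ := ν) hne
    fun w h0 h1 => lift_map_eval_cyl hν h0 h1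
  constructor <;> linarith

/-! ### Measures on the torus are determined by their Fourier coefficients -/

/-- Trigonometric polynomials form a point-separating star subalgebra, which determines finite
measures; by linearity it suffices to compare integrals of characters. -/
theorem ext_of_fourierCoeffMeasure {μ ρ : Measure UnitAddCircle} [IsFiniteMeasure μ]
    [IsFiniteMeasure ρ] (h : ∀ k, fourierCoeffMeasure μ k = fourierCoeffMeasure ρ k) : μ = ρ := by
  let A : StarSubalgebra ℂ (BoundedContinuousFunction UnitAddCircle ℂ) :=
    (fourierSubalgebra (T := (1 : ℝ))).comap
      (BoundedContinuousFunction.toContinuousMapStarₐ ℂ)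
  refine ext_of_forall_mem_subalgebra_integral_eq_of_polish (𝕜 := ℂ) (A := A) ?_ ?_
  · intro y z hyz
    obtain ⟨_, ⟨f, hf, rfl⟩, hne⟩ := fourierSubalgebra_separatesPoints (T := (1 : ℝ)) hyz
    exact ⟨f, ⟨f, ⟨BoundedContinuousFunction.mkOfCompact f, hf, rfl⟩, rfl⟩, hne⟩
  · intro g hg
    have hspan : g.toContinuousMap ∈ Submodule.span ℂ (Set.range (@fourier (1 : ℝ))) := by
      rw [← fourierSubalgebra_coe]
      exact hg
    have hint : ∀ (f : C(UnitAddCircle, ℂ)) (τ : Measure UnitAddCircle) [IsFiniteMeasure τ],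
        Integrable f τ := fun f τ _ =>
      f.continuous.integrable_of_hasCompactSupport (HasCompactSupport.of_compactSpace f)
    change ∫ y, g.toContinuousMap y ∂μ = ∫ y, g.toContinuousMap y ∂ρ
    generalize g.toContinuousMap = f at hspan
    induction hspan using Submodule.span_induction with
    | mem f hf => obtain ⟨k, rfl⟩ := hf; exact h k
    | zero => simp
    | add f f' _ _ hf hf' =>
      simp only [ContinuousMap.add_apply]
      rw [integral_add (hint f _) (hint f' _), integral_add (hint f _) (hint f' _), hf, hf']
    | smul a f _ hf =>
      simp only [ContinuousMap.smul_apply]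
      rw [integral_smul, integral_smul, hf]

theorem fourierCoeffMeasure_zero (μ : Measure UnitAddCircle) :
    fourierCoeffMeasure μ 0 = (μ.real Set.univ : ℂ) := by
  simp [fourierCoeffMeasure]

/-! ### Empirical measures and their limit points -/

/-- The uniform distribution on `x, T x, …, T^n x`. -/
noncomputable def empirical (x : BinSeq) (n : ℕ) : ProbabilityMeasure BinSeq :=
  ⟨((n + 1 : ℕ) : NNReal)⁻¹ • ∑ j ∈ Finset.range (n + 1), Measure.dirac (shift^[j] x), ⟨by
    have h : ((n + 1 : ℕ) : NNReal) ≠ 0 := by positivity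
    rw [Measure.smul_apply, Measure.finsetSum_apply]
    simp only [measure_univ, Finset.sum_const, Finset.card_range, nsmul_eq_mul, mul_one]
    rw [ENNReal.smul_def, smul_eq_mul, ENNReal.coe_inv h, ENNReal.coe_natCast]
    exact ENNReal.inv_mul_cancel (by simp) (ENNReal.natCast_ne_top _)⟩⟩

theorem integral_empirical {E : Type*} [NormedAddCommGroup E] [NormedSpace ℝ E] [CompleteSpace E]
    (x : BinSeq) (n : ℕ) {f : BinSeq → E} (hf : StronglyMeasurable f) :
    ∫ y, f y ∂(empirical x n : Measure BinSeq)
      = ((n + 1 : ℕ) : ℝ)⁻¹ • ∑ j ∈ Finset.range (n + 1), f (shift^[j] x) := by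
  have hi : ∀ j ∈ Finset.range (n + 1), Integrable f (Measure.dirac (shift^[j] x)) :=
    fun j _ => integrable_dirac' hf (by simp)
  rw [empirical, ProbabilityMeasure.coe_mk, integral_smul_nnreal_measure,
    integral_finsetSum_measure hi]
  simp only [integral_dirac' _ _ hf]
  rw [NNReal.smul_def]
  simp

theorem integral_fourier_eval_empirical (x : BinSeq) (k : ℤ) (n : ℕ) :
    ∫ y, fourier k (eval y) ∂(empirical x n : Measure BinSeq) = weylAverage x k (n + 1) := by
  rw [integral_empirical x n (f := fun y => fourier k (eval y))
    ((fourier k).continuous.comp continuous_eval).stronglyMeasurable, weylAverage,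
    Complex.real_smul]
  simp

/-- A prefix of length `n + l` has exactly `n + 1` windows of length `l`, one for each point of the
empirical measure, so there is no boundary error. -/
theorem empirical_real_cyl (x : BinSeq) (n : ℕ) {l : ℕ} (w : Word l) :
    (empirical x n : Measure BinSeq).real (cyl w) = slidingProb x (n + l) w := by
  have hm := measurableSet_cyl w
  rw [← integral_indicator_one hm,
    integral_empirical x n (stronglyMeasurable_one.indicator hm), slidingProb]
  have e : n + l + 1 - l = n + 1 := by omega
  rw [e, Finset.card_filter, smul_eq_mul, div_eq_inv_mul]
  push_cast
  congr 1
  · congr 1; ring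
  · refine Finset.sum_congr rfl fun j _ => ?_
    simp [Set.indicator_apply, cyl, iterate_shift_apply, add_comm]

/-- The difference telescopes to two boundary terms divided by `n + 1`. -/
theorem tendsto_integral_shift_sub (x : BinSeq) (f : BoundedContinuousFunction BinSeq ℝ) :
    Tendsto (fun n => ∫ y, f (shift y) ∂(empirical x n : Measure BinSeq)
      - ∫ y, f y ∂(empirical x n : Measure BinSeq)) atTop (nhds 0) := by
  have hlim : Tendsto (fun n : ℕ => ((n + 1 : ℕ) : ℝ)⁻¹ * (2 * ‖f‖)) atTop (nhds 0) := by
    have h := (tendsto_inv_atTop_nhds_zero_nat (𝕜 := ℝ)).comp (tendsto_add_atTop_nat 1)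
    simpa using h.mul_const (2 * ‖f‖)
  refine squeeze_zero_norm (fun n => ?_) hlim
  rw [integral_empirical x n (f := fun y => f (shift y))
      (f.continuous.comp continuous_shift).stronglyMeasurable,
    integral_empirical x n f.continuous.stronglyMeasurable, ← smul_sub, ← Finset.sum_sub_distrib]
  have e : ∀ j, f (shift (shift^[j] x)) = f (shift^[j + 1] x) := fun j => by
    rw [Function.iterate_succ_apply']
  simp only [e]
  rw [Finset.sum_range_sub (fun j => f (shift^[j] x)), norm_smul,
    Real.norm_of_nonneg (by positivity)]
  refine mul_le_mul_of_nonneg_left ?_ (by positivity)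
  refine (norm_sub_le _ _).trans ?_
  linarith [f.norm_coe_le_norm (shift^[n + 1] x), f.norm_coe_le_norm (shift^[0] x)]

theorem measurePreserving_shift_of_tendsto_empirical {x : BinSeq} {F : Filter ℕ} [F.NeBot]
    (hF : F ≤ atTop) {ν : ProbabilityMeasure BinSeq} (h : Tendsto (empirical x) F (nhds ν)) :
    MeasurePreserving shift (ν : Measure BinSeq) (ν : Measure BinSeq) := by
  refine ⟨continuous_shift.measurable, ?_⟩
  have : IsProbabilityMeasure ((ν : Measure BinSeq).map shift) :=
    Measure.isProbabilityMeasure_map continuous_shift.aemeasurable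
  refine ext_of_forall_integral_eq_of_IsFiniteMeasure fun f => ?_
  rw [integral_map continuous_shift.aemeasurable f.continuous.aestronglyMeasurable]
  have hint := ProbabilityMeasure.tendsto_iff_forall_integral_tendsto.1 h
  have h1 := hint (f.compContinuous ⟨shift, continuous_shift⟩)
  have h2 := h1.sub (hint f)
  exact sub_eq_zero.1 (tendsto_nhds_unique h2 ((tendsto_integral_shift_sub x f).mono_left hF))

theorem fourierCoeffMeasure_map_eval_of_tendsto_empirical {x : BinSeq} {c : ℤ → ℂ}
    (hc : ∀ k : ℤ, Tendsto (fun n : ℕ => weylAverage x k n) atTop (nhds (c k)))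
    {F : Filter ℕ} [F.NeBot] (hF : F ≤ atTop) {ν : ProbabilityMeasure BinSeq}
    (h : Tendsto (empirical x) F (nhds ν)) (k : ℤ) :
    fourierCoeffMeasure ((ν : Measure BinSeq).map eval) k = c k := by
  rw [fourierCoeffMeasure, integral_map continuous_eval.aemeasurable
    (fourier k).continuous.aestronglyMeasurable]
  have h1 := (ProbabilityMeasure.tendsto_iff_forall_integral_rclike_tendsto ℂ).1 h
    (BoundedContinuousFunction.mkOfCompact ((fourier k).comp ⟨eval, continuous_eval⟩))
  simp only [BoundedContinuousFunction.mkOfCompact_apply, ContinuousMap.comp_apply,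
    ContinuousMap.coe_mk, integral_fourier_eval_empirical] at h1
  exact tendsto_nhds_unique h1 (((hc k).comp (tendsto_add_atTop_nat 1)).mono_left hF)

/-! ### Sliding entropies as block entropies of limit measures -/

theorem isClopen_cyl {l : ℕ} (w : Word l) : IsClopen (cyl w) := by
  have : cyl w = ⋂ i : Fin l, (fun x : BinSeq => x i) ⁻¹' {w i} := by
    ext x; simp [cyl]
  rw [this]
  exact isClopen_iInter_of_finite fun i => (isClopen_discrete _).preimage (continuous_apply _)

theorem slidingEntropy_eq (x : BinSeq) (l n : ℕ) :
    slidingEntropy x l n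
      = (∑ w : Word l, Real.negMulLog (slidingProb x n w)) / Real.log 2 / l := by
  rw [slidingEntropy, Finset.mul_sum, Finset.sum_div, Finset.sum_div]
  refine Finset.sum_congr rfl fun w _ => ?_
  rw [Real.negMulLog, Real.logb]
  ring

theorem tendsto_slidingEntropy {x : BinSeq} {F : Filter ℕ} {ν : ProbabilityMeasure BinSeq}
    (h : Tendsto (empirical x) F (nhds ν)) (l : ℕ) :
    Tendsto (fun n => slidingEntropy x l (n + l)) F (nhds (cylEntropy ν l / l)) := by
  simp only [slidingEntropy_eq, cylEntropy_eq, ← empirical_real_cyl]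
  refine ((tendsto_finsetSum _ fun w _ => ?_).div_const _).div_const _
  refine (Real.continuous_negMulLog.tendsto _).comp ?_
  exact (NNReal.tendsto_coe.2
    (ProbabilityMeasure.tendsto_measure_of_isClopen_of_tendsto h (isClopen_cyl w)))

/-! ### Comparison of the entropy rates -/

/-- If every limit of `u` along an ultrafilter finer than `F` lies in `[a, b]`, then so do the lower
and the upper limit. -/
theorem le_liminf_and_limsup_le_of_ultrafilter {α : Type*} {F : Filter α} [F.NeBot] {u : α → ℝ}
    {a b : ℝ} (h : ∀ V : Ultrafilter α, ↑V ≤ F → ∃ L ∈ Set.Icc a b, Tendsto u V (nhds L)) :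
    a ≤ liminf u F ∧ liminf u F ≤ limsup u F ∧ limsup u F ≤ b := by
  have hev : ∀ ε > 0, ∀ᶠ n in F, a - ε < u n ∧ u n < b + ε := by
    intro ε hε
    -- An event is eventual along `F` as soon as it is so along every finer ultrafilter.
    refine mem_iff_ultrafilter.2 fun V hV => ?_
    obtain ⟨L, hL, hlim⟩ := h V hV
    exact hlim (Ioo_mem_nhds (by linarith [hL.1]) (by linarith [hL.2]))
  have h1 := hev 1 one_pos
  have hle : F.IsBoundedUnder (· ≤ ·) u := ⟨b + 1, h1.mono fun n hn => hn.2.le⟩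
  have hge : F.IsBoundedUnder (· ≥ ·) u := ⟨a - 1, h1.mono fun n hn => hn.1.le⟩
  refine ⟨le_of_forall_pos_sub_le fun ε hε => ?_, liminf_le_limsup hle hge,
    le_of_forall_pos_le_add fun ε hε => ?_⟩
  · exact le_liminf_of_le hle.isCoboundedUnder_ge ((hev ε hε).mono fun n hn => hn.1.le)
  · exact limsup_le_of_le hge.isCoboundedUnder_le ((hev ε hε).mono fun n hn => hn.2.le)

/-- The entropy rate of a shift-invariant measure is that of the lift of its projection. -/
theorem tendsto_cylEntropy_div_of_lift {ν : Measure BinSeq} [IsProbabilityMeasure ν]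
    (hν : MeasurePreserving shift ν ν) {h : ℝ}
    (hlim : Tendsto (fun n : ℕ => cylEntropy (lift (ν.map eval)) n / n) atTop (nhds h)) :
    Tendsto (fun n : ℕ => cylEntropy ν n / n) atTop (nhds h) := by
  have hd : Tendsto (fun n : ℕ => cylEntropy ν n / n - cylEntropy (lift (ν.map eval)) n / n)
      atTop (nhds 0) := by
    refine squeeze_zero_norm' ?_ (tendsto_inv_atTop_nhds_zero_nat (𝕜 := ℝ))
    filter_upwards [eventually_ne_atTop 0] with n hn
    rw [← sub_div, norm_div, Real.norm_natCast, Real.norm_eq_abs, ← one_div]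
    exact div_le_div_of_nonneg_right (abs_cylEntropy_sub_lift_le hν hn) n.cast_nonneg
  simpa using hd.add hlim

/-- The lower bound is Fekete's lemma, by which the rate is the infimum; the upper bound is the
one-bit comparison. Both ends depend on `ν` only through its projection. -/
theorem cylEntropy_div_mem_Icc {ν : Measure BinSeq} [IsProbabilityMeasure ν]
    (hν : MeasurePreserving shift ν ν) {h : ℝ}
    (hlim : Tendsto (fun n : ℕ => cylEntropy (lift (ν.map eval)) n / n) atTop (nhds h))
    {l : ℕ} (hl : l ≠ 0) :
    cylEntropy ν l / l ∈ Set.Icc h ((cylEntropy (lift (ν.map eval)) l + 1) / l) := by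
  have hb := bddBelow_cylEntropy_div ν
  have hsub := subadditive_cylEntropy hν
  constructor
  · rw [tendsto_nhds_unique (tendsto_cylEntropy_div_of_lift hν hlim) (hsub.tendsto_lim hb)]
    exact hsub.lim_le_div hb hl
  · refine div_le_div_of_nonneg_right ?_ l.cast_nonneg
    linarith [(abs_le.1 (abs_cylEntropy_sub_lift_le hν hl)).2]

theorem exists_tendsto_empirical (x : BinSeq) (V : Ultrafilter ℕ) :
    ∃ ν : ProbabilityMeasure BinSeq, Tendsto (empirical x) V (nhds ν) :=
  ⟨_, (V.map (empirical x)).le_nhds_lim⟩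

/-- This gives uniqueness among all measures: infinite mass is excluded because `Measure.real` would
then be `0`, not `1`. -/
theorem isProbabilityMeasure_of_fourierCoeffMeasure_zero {ρ : Measure UnitAddCircle}
    (h : fourierCoeffMeasure ρ 0 = 1) : IsProbabilityMeasure ρ := by
  rw [fourierCoeffMeasure_zero] at h
  have h1 : ρ.real Set.univ = 1 := by exact_mod_cast h
  refine ⟨?_⟩
  rw [measureReal_def] at h1
  exact (ENNReal.toReal_eq_one_iff _).1 h1

/-- If the Weyl averages of `x` converge to the Fourier coefficients of `μ`, and the block entropies
of the lift of `μ` have rate `h`, then `h` is both finite-state dimensions of `x`. -/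
theorem dimFS_eq_and_strongDimFS_eq {x : BinSeq} {μ : Measure UnitAddCircle}
    [IsProbabilityMeasure μ]
    (hc : ∀ k : ℤ, Tendsto (fun n : ℕ => weylAverage x k n) atTop
      (nhds (fourierCoeffMeasure μ k))) {h : ℝ}
    (hlim : Tendsto (fun n : ℕ => cylEntropy (lift μ) n / n) atTop (nhds h)) :
    dimFS x = h ∧ strongDimFS x = h := by
  have key : ∀ l : ℕ+, h ≤ liminf (fun n => slidingEntropy x l n) atTop ∧
      liminf (fun n => slidingEntropy x l n) atTop ≤ limsup (fun n => slidingEntropy x l n) atTop ∧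
      limsup (fun n => slidingEntropy x l n) atTop ≤ (cylEntropy (lift μ) l + 1) / (l : ℕ) := by
    intro l
    -- Replacing `n` by `n + l` aligns the prefixes with the empirical measures.
    rw [← liminf_nat_add (fun n => slidingEntropy x l n) l,
      ← limsup_nat_add (fun n => slidingEntropy x l n) l]
    refine le_liminf_and_limsup_le_of_ultrafilter fun V hV => ?_
    obtain ⟨ν, hν⟩ := exists_tendsto_empirical x V
    have hμ : (ν : Measure BinSeq).map eval = μ := by
      have : IsProbabilityMeasure ((ν : Measure BinSeq).map eval) :=
        Measure.isProbabilityMeasure_map continuous_eval.aemeasurable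
      exact ext_of_fourierCoeffMeasure
        (fourierCoeffMeasure_map_eval_of_tendsto_empirical hc hV hν)
    have hinv := measurePreserving_shift_of_tendsto_empirical hV hν
    have hmem := cylEntropy_div_mem_Icc hinv (by rwa [hμ]) l.ne_zero
    rw [hμ] at hmem
    exact ⟨_, hmem, tendsto_slidingEntropy hν l⟩
  have hupper : Tendsto (fun n : ℕ => (cylEntropy (lift μ) n + 1) / n) atTop (nhds h) := by
    simpa [add_div] using hlim.add (tendsto_one_div_atTop_nhds_zero_nat (𝕜 := ℝ))
  have hbl : BddBelow (Set.range fun l : ℕ+ => liminf (fun n => slidingEntropy x l n) atTop) :=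
    ⟨h, by rintro _ ⟨l, rfl⟩; exact (key l).1⟩
  have hbs : BddBelow (Set.range fun l : ℕ+ => limsup (fun n => slidingEntropy x l n) atTop) :=
    ⟨h, by rintro _ ⟨l, rfl⟩; exact (key l).1.trans (key l).2.1⟩
  have h1 : h ≤ dimFS x := le_ciInf fun l => (key l).1
  have h2 : dimFS x ≤ strongDimFS x := ciInf_mono hbl fun l => (key l).2.1
  have h3 : strongDimFS x ≤ h := by
    -- The infimum lies below the bound for every block length, and the extra bit divided by the
    -- length vanishes in the limit.
    refine ge_of_tendsto hupper ?_
    filter_upwards [eventually_gt_atTop 0] with n hn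
    exact (ciInf_le hbs ⟨n, hn⟩).trans (key ⟨n, hn⟩).2.2
  exact ⟨le_antisymm (h2.trans h3) h1, le_antisymm h3 (h1.trans h2)⟩

end WeylFSD

/-! ### The main theorem -/

theorem mainTheorem2 (x : WeylFSD.BinSeq) (c : ℤ → ℂ)
    (hc : ∀ k : ℤ, Filter.Tendsto (fun n : ℕ => WeylFSD.weylAverage x k n) Filter.atTop
      (nhds (c k))) :
    ∃ μ : MeasureTheory.Measure UnitAddCircle,
      MeasureTheory.IsProbabilityMeasure μ ∧
      (∀ k : ℤ, c k = WeylFSD.fourierCoeffMeasure μ k) ∧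
      (∀ ρ : MeasureTheory.Measure UnitAddCircle,
        (∀ k : ℤ, c k = WeylFSD.fourierCoeffMeasure ρ k) → ρ = μ) ∧
      WeylFSD.dimFS x = WeylFSD.strongDimFS x ∧
      WeylFSD.strongDimFS x = WeylFSD.lowerEntropy (WeylFSD.lift μ) ∧
      WeylFSD.lowerEntropy (WeylFSD.lift μ) = WeylFSD.upperEntropy (WeylFSD.lift μ) ∧
      WeylFSD.IsRegular x := by
  have hV := Ultrafilter.of_le (atTop : Filter ℕ)
  -- The witness for `μ` is the projection of the limit along one arbitrary ultrafilter. Its lift is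
  -- shift-invariant, so its entropy rate exists.
  obtain ⟨ν, hν⟩ := WeylFSD.exists_tendsto_empirical x (Ultrafilter.of atTop)
  have hinv := WeylFSD.measurePreserving_shift_of_tendsto_empirical hV hν
  have hcoeff := WeylFSD.fourierCoeffMeasure_map_eval_of_tendsto_empirical hc hV hν
  have hprob : IsProbabilityMeasure ((ν : Measure WeylFSD.BinSeq).map WeylFSD.eval) :=
    Measure.isProbabilityMeasure_map WeylFSD.continuous_eval.aemeasurable
  have hsub := WeylFSD.subadditive_cylEntropy
    (WeylFSD.measurePreserving_shift_lift_map_eval hinv)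
  have hlim := hsub.tendsto_lim (WeylFSD.bddBelow_cylEntropy_div _)
  obtain ⟨hd, hD⟩ := WeylFSD.dimFS_eq_and_strongDimFS_eq (fun k => by rw [hcoeff]; exact hc k) hlim
  refine ⟨_, hprob, fun k => (hcoeff k).symm, fun ρ hρ => ?_, hd.trans hD.symm,
    hD.trans hlim.liminf_eq.symm, hlim.liminf_eq.trans hlim.limsup_eq.symm, hd.trans hD.symm⟩
  have : IsProbabilityMeasure ρ := by
    refine WeylFSD.isProbabilityMeasure_of_fourierCoeffMeasure_zero ?_
    rw [← hρ 0, ← hcoeff 0, WeylFSD.fourierCoeffMeasure_zero]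
    simp
  exact WeylFSD.ext_of_fourierCoeffMeasure fun k => by rw [← hρ k, hcoeff k]
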